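/- Notation. For $q\in\mathbb C$ with $0<|q|<1$ put $(a;q)_\infty=\prod_{n\ge 0}(1-aq^n)$, $(a;q)_k=\prod_{n=0}^{k-1}(1-aq^n)$; $(x_1,\dots,x_p;q)_k=(x_1;q)_k\cdots(x_p;q)_k$ for $k\in\mathbb N_0\cup\{\infty\}$; $\Omega_q=\{q^{-k}:k\in\mathbb N_0\}$; $a_{ij}=a_ia_j$ and $a_{123456}=a_1a_2\cdots a_6$. A sign $\pm$ in a list means that both elements occur, and $\mathbf a e^{\pm i\psi}$ stands for the twelve elements $a_je^{i\psi},a_je^{-i\psi}$, $1\le j\le 6$. The very-well-poised series is $${}_{10}W_9(b;x_1,\dots,x_7;q,z)=\sum_{k=0}^\infty\frac{(\pm q\sqrt b,\,b,\,x_1,\dots,x_7;q)_k}{(q,\,\pm\sqrt b,\,qb/x_1,\dots,qb/x_7;q)_k}\,z^k .$$ The symmetric sum $\mathbb I_{a_1;a_2,\dots,a_6}f(a_1,\dots,a_6)$ is $f(a_1,\dots,a_6)$ plus the five expressions obtained from it by interchanging $a_1$ with $a_k$, $k=2,\dots,6$. Theorem (generalized Rahman integral). Let $q,a_1,\dots,a_6,\lambda,\mu\in\mathbb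 C\setminus\{0\}$ with $|q|<1$, $\max(|a_1|,\dots,|a_6|)<1$ and $|q\lambda\mu|<|a_{123456}|$ (so $|q\lambda\mu|<|a_{123456}|<1$). Assume that the right-hand side below is defined, i.e. $a_i/a_j\notin\Omega_q$ for $i\neq j$ and $a_i\lambda,\,a_i\mu\notin\Omega_q$ for all $i$. Then the integrand below is integrable on $[-\pi,\pi]$, the six ${}_{10}W_9$ series converge absolutely, and $$\int_{-\pi}^{\pi}\frac{(e^{\pm 2i\psi},\lambda e^{\pm i\psi},\mu e^{\pm i\psi};q)_\infty}{(\mathbf a e^{\pm i\psi};q)_\infty}\,d\psi =\frac{2\pi}{(q;q)_\infty}\,\mathbb I_{a_1;a_2,\dots,a_6}\; \frac{\bigl(a_1^{-2},a_1\lambda,a_1\mu,\frac{\lambda}{a_1},\frac{\mu}{a_1};q\bigr)_\infty}{\bigl(a_{12},\dots,a_{16},\frac{a_2}{a_1},\dots,\frac{a_6}{a_1};q\bigr)_\infty}\; {}_{10}W_9\!\left(a_1^2;a_{12},\dots,a_{16},\tfrac{qa_1}{\lambda},\tfrac{qa_1}{\mu};q,\tfrac{q\lambda\mu}{a_{123456}}\right).$$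 In particular, no relation $\lambda\mu=a_{123456}$ (as in Rahman's integral) is required. -/

import Mathlib

open MeasureTheory

noncomputable section

/-- The infinite `q`-shifted factorial `(a;q)_∞ = ∏_{n ≥ 0} (1 - a q^n)` (for `|q| < 1`). -/
def qPochInf (a q : ℂ) : ℂ := ∏' n : ℕ, (1 - a * q ^ n)

/-- The finite `q`-shifted factorial `(a;q)_k = (1 - a)(1 - a q) ⋯ (1 - a q^{k-1})`. -/
def qPoch (a q : ℂ) (k : ℕ) : ℂ := ∏ n ∈ Finset.range k, (1 - a * q ^ n)

/-- `(a_1, …, a_m; q)_∞ = (a_1;q)_∞ ⋯ (a_m;q)_∞`. -/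
def qPochInfs (as : List ℂ) (q : ℂ) : ℂ := (as.map fun a => qPochInf a q).prod

/-- `(a_1, …, a_m; q)_k = (a_1;q)_k ⋯ (a_m;q)_k`. -/
def qPochs (as : List ℂ) (q : ℂ) (k : ℕ) : ℂ := (as.map fun a => qPoch a q k).prod

/-- `Ω_q = {q^{-k} : k = 0, 1, 2, …}`. -/
def qOmega (q : ℂ) : Set ℂ := {x | ∃ k : ℕ, x = (q ^ k)⁻¹}

/-- The `k`-th term of the basic hypergeometric series `_{r+1}φ_s(as; bs; q, z)`, with
`r + 1 = as.length` and `s = bs.length`; the exponent below is `s - r`. -/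
def qHypTerm (as bs : List ℂ) (q z : ℂ) (k : ℕ) : ℂ :=
  qPochs as q k / qPochs (q :: bs) q k
    * ((-1) ^ k * q ^ k.choose 2) ^ ((bs.length : ℤ) + 1 - (as.length : ℤ)) * z ^ k

/-- The basic hypergeometric series `_{r+1}φ_s(as; bs; q, z)`. -/
def qHyp (as bs : List ℂ) (q z : ℂ) : ℂ := ∑' k : ℕ, qHypTerm as bs q z k

/-- The (principal) square root; the very-well-poised series below involve only the
unordered pair `± √b`, hence do not depend on the branch. -/
def csqrt (b : ℂ) : ℂ := b ^ (1 / 2 : ℂ)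

/-- The numerator parameters `± q √b, b, a_4, …, a_{r+1}` of a very-well-poised series. -/
def vwpTop (b : ℂ) (as : List ℂ) (q : ℂ) : List ℂ :=
  [q * csqrt b, -(q * csqrt b), b] ++ as

/-- The denominator parameters `± √b, q b / a_4, …, q b / a_{r+1}` of a very-well-poised
series. -/
def vwpBot (b : ℂ) (as : List ℂ) (q : ℂ) : List ℂ :=
  [csqrt b, -csqrt b] ++ as.map fun a => q * b / a

/-- The very-well-poised basic hypergeometric series `_{r+1}W_r(b; a_4, …, a_{r+1}; q, z)`, where
`as = [a_4, …, a_{r+1}]`. -/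
def qW (b : ℂ) (as : List ℂ) (q z : ℂ) : ℂ := qHyp (vwpTop b as q) (vwpBot b as q) q z

/-- Convergence of the series `_{r+1}W_r(b; a_4, …, a_{r+1}; q, z)`. -/
def qWConverges (b : ℂ) (as : List ℂ) (q z : ℂ) : Prop :=
  Summable (qHypTerm (vwpTop b as q) (vwpBot b as q) q z)

/-- The symmetric sum `f(a_1, …, a_n) + idem(a_1; a_2, …, a_n)`: the sum of `f(a_1, …, a_n)` and of
the `n - 1` expressions obtained from it by interchanging `a_1` with `a_k`, `k = 2, …, n`. -/
def symSum {n : ℕ} (f : (Fin (n + 1) → ℂ) → ℂ) (a : Fin (n + 1) → ℂ) : ℂ :=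
  f a + ∑ k : Fin n, f (a ∘ Equiv.swap 0 k.succ)

/-- The integrand
`(e^{± 2iψ}, l e^{± iψ}, m e^{± iψ}; q)_∞ / (a_1 e^{± iψ}, …, a_6 e^{± iψ}; q)_∞`. -/
def rahmanIntegrand (q l m : ℂ) (a : Fin 6 → ℂ) (ψ : ℝ) : ℂ :=
  qPochInfs [Complex.exp (2 * Complex.I * ψ), Complex.exp (-(2 * Complex.I * ψ)),
      l * Complex.exp (Complex.I * ψ), l * Complex.exp (-(Complex.I * ψ)),
      m * Complex.exp (Complex.I * ψ), m * Complex.exp (-(Complex.I * ψ))] q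
    / (qPochInfs (List.ofFn fun j : Fin 6 => a j * Complex.exp (Complex.I * ψ)) q
      * qPochInfs (List.ofFn fun j : Fin 6 => a j * Complex.exp (-(Complex.I * ψ))) q)

/-- The prefactor `(a_1^{-2}, a_1 l, a_1 m, l/a_1, m/a_1; q)_∞ /
(a_1 a_2, …, a_1 a_6, a_2/a_1, …, a_6/a_1; q)_∞`. -/
def rahmanCoeff (q l m : ℂ) (a : Fin 6 → ℂ) : ℂ :=
  qPochInfs [(a 0 ^ 2)⁻¹, a 0 * l, a 0 * m, l / a 0, m / a 0] q
    / (qPochInfs (List.ofFn fun j : Fin 5 => a 0 * a j.succ) q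
      * qPochInfs (List.ofFn fun j : Fin 5 => a j.succ / a 0) q)

/-- The parameters `a_1 a_2, …, a_1 a_6, q a_1 / l, q a_1 / m` of the `_{10}W_9` series. -/
def rahmanParams (q l m : ℂ) (a : Fin 6 → ℂ) : List ℂ :=
  (List.ofFn fun j : Fin 5 => a 0 * a j.succ) ++ [q * a 0 / l, q * a 0 / m]

end

/-! Put `z = exp (I * ψ)`: the integral becomes the contour integral of `F z / z` over the unit
circle, up to the factor `I`, where `F` is `rahmanFun`. Inside the circle `F` can be singular only
at the points `a i * q ^ k`, which accumulate at the essential difficulty `z = 0`, and at `0`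
itself. Everything rests on one functional equation, `F (q * z) = R z * F z` with `R` rational
(`rahmanFun_mul`). At the poles, it says that successive residues have quotient `R (a i * q ^ k)`,
which is exactly the quotient of successive terms of the very-well-poised series
(`rahmanTerm_succ`); the residue at `a i` supplies the prefactor (`residue_zero`). Near `0`, `R` is
close to `R 0 = q * l * m / ∏ j, a j`, of modulus less than 1, so `F` decays geometrically on the
circles of radius `‖q‖ ^ N * ρ` and the integrals of `F z / z` over them tend to `0`. The same bound
gives convergence of the series. The residue theorem on the annuli between these circles and the
unit circle then yields the sum over all poles as `N` grows. No balancing relation enters, only `‖R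
0‖ < 1`. -/

/-! ### Residue theorem on an annulus, for simple poles -/

open Filter Topology Set in
-- Induction on the set of poles: subtracting `res p / (z - p)` makes `p` removable, and this
-- principal part integrates to `2πi * res p` over the outer circle and to `0` over the inner one.
-- The function is quantified after `S` because it changes at each step.
theorem circleIntegral_sub_eq_sum_residue {r R : ℝ} (hr : 0 < r) (hrR : r ≤ R) (S : Finset ℂ)
    (res : ℂ → ℂ) (hS : ∀ p ∈ S, r < ‖p‖ ∧ ‖p‖ < R) :
    ∀ g : ℂ → ℂ, (∀ z, r ≤ ‖z‖ → ‖z‖ ≤ R → z ∉ S → DifferentiableAt ℂ g z) →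
      (∀ p ∈ S, Tendsto (fun z => (z - p) * g z) (𝓝[≠] p) (𝓝 (res p))) →
      (∮ z in C(0, R), g z) - (∮ z in C(0, r), g z) =
        2 * Real.pi * Complex.I * ∑ p ∈ S, res p := by
  have hR : 0 < R := hr.trans_le hrR
  induction S using Finset.induction_on with
  | empty =>
    intro g hg _
    rw [Complex.circleIntegral_eq_of_differentiable_on_annulus_off_countable hr hrR
      (s := ∅) countable_empty]
    · simp
    · rintro z ⟨h1, h2⟩
      exact (hg z (by simpa using h2) (by simpa using h1)
        (by simp)).continuousAt.continuousWithinAt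
    · rintro z ⟨⟨h1, h2⟩, -⟩
      exact hg z (by simpa using (not_le.1 (by simpa using h2)).le)
        (by simpa using (mem_ball_zero_iff.1 h1).le) (by simp)
  | insert p S hp ih =>
    intro g hg hres
    obtain ⟨hp1, hp2⟩ := hS p (Finset.mem_insert_self p S)
    have hzp : ∀ z, z ≠ p → DifferentiableAt ℂ (fun z => res p / (z - p)) z := fun z hz =>
      (differentiableAt_const _).div (by fun_prop) (sub_ne_zero.2 hz)
    set g0 : ℂ → ℂ := fun z => g z - res p / (z - p) with hg0
    set g1 := Function.update g0 p (limUnder (𝓝[≠] p) g0) with hg1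
    have hgp : ∀ᶠ z in 𝓝[≠] p, DifferentiableAt ℂ g z := by
      have h1 : ∀ᶠ z in 𝓝[≠] p, r < ‖z‖ ∧ ‖z‖ < R :=
        (((continuous_norm.tendsto p).eventually (lt_mem_nhds hp1)).and
          ((continuous_norm.tendsto p).eventually (gt_mem_nhds hp2))).filter_mono nhdsWithin_le_nhds
      have h2 : ∀ᶠ z in 𝓝[≠] p, z ∉ S :=
        nhdsWithin_le_nhds (S.finite_toSet.isClosed.isOpen_compl.mem_nhds (by simpa using hp))
      filter_upwards [h1, h2, self_mem_nhdsWithin] with z h1 h2 h3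
      exact hg z h1.1.le h1.2.le (by simp [h2]; exact h3)
    have hd1 : ∀ z, z ≠ p → DifferentiableAt ℂ g z → DifferentiableAt ℂ g1 z := by
      intro z hz hgz
      refine (hgz.sub (hzp z hz)).congr_of_eventuallyEq ?_
      filter_upwards [isOpen_ne.mem_nhds hz] with w hw
      simp [hg1, Function.update_of_ne hw, hg0]
    have hdp : DifferentiableAt ℂ g1 p := by
      have hs : {z | z = p ∨ DifferentiableAt ℂ g z} ∈ 𝓝 p := by
        rw [eventually_nhdsWithin_iff] at hgp
        filter_upwards [hgp] with z hz
        by_cases h : z = p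
        · exact Or.inl h
        · exact Or.inr (hz h)
      refine (Complex.differentiableOn_update_limUnder_of_isLittleO (f := g0) (c := p) hs ?_ ?_
        ).differentiableAt hs
      · rintro z ⟨hz1 | hz1, hz2⟩
        · exact absurd hz1 hz2
        · exact (hz1.sub (hzp z hz2)).differentiableWithinAt
      · have h1 : Tendsto (fun z => (z - p) * g z - res p) (𝓝[≠] p) (𝓝 0) := by
          simpa using (hres p (Finset.mem_insert_self p S)).sub_const (res p)
        -- The removability criterion compares with the arbitrary value `g0 p`; the factor `z - p`
        -- makes that value irrelevant.
        have h2 : Tendsto (fun z => (z - p) * (g0 z - g0 p)) (𝓝[≠] p) (𝓝 0) := by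
          have h3 : Tendsto (fun z => (z - p) * g0 p) (𝓝[≠] p) (𝓝 0) := by
            have : Continuous (fun z => (z - p) * g0 p) := by fun_prop
            simpa using (this.tendsto p).mono_left nhdsWithin_le_nhds
          have h4 := h1.sub h3
          rw [sub_zero] at h4
          refine h4.congr' ?_
          filter_upwards [self_mem_nhdsWithin] with z hz
          have : z - p ≠ 0 := sub_ne_zero.2 hz
          simp only [hg0]
          field_simp
        rw [Asymptotics.isLittleO_iff_tendsto']
        · refine h2.congr fun z => ?_
          rw [div_inv_eq_mul, mul_comm]
        · filter_upwards [self_mem_nhdsWithin] with z hz h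
          exact absurd (inv_eq_zero.1 h) (sub_ne_zero.2 hz)
    have key := ih (fun p' hp' => hS p' (Finset.mem_insert_of_mem hp')) g1 ?_ ?_
    · have hnp : ∀ ρ : ℝ, 0 < ρ → ρ ≠ ‖p‖ → r ≤ ρ → ρ ≤ R → (∀ p' ∈ S, ρ ≠ ‖p'‖) →
          (∮ z in C(0, ρ), g1 z) =
            (∮ z in C(0, ρ), g z) - res p * ∮ z in C(0, ρ), (z - p)⁻¹ := by
        intro ρ hρ hρp h1 h2 h3
        have hne : ∀ z ∈ Metric.sphere (0 : ℂ) ρ, z ≠ p := by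
          rintro z hz rfl
          exact hρp (by simpa using hz.symm)
        rw [← circleIntegral.integral_const_mul, ← circleIntegral.integral_sub]
        · refine circleIntegral.integral_congr hρ.le fun z hz => ?_
          simp [hg1, Function.update_of_ne (hne z hz), hg0, div_eq_mul_inv]
        · refine ContinuousOn.circleIntegrable hρ.le fun z hz => ?_
          have hz' : ‖z‖ = ρ := by simpa using hz
          refine (hg z (hz' ▸ h1) (hz' ▸ h2) ?_).continuousAt.continuousWithinAt
          simp only [Finset.mem_insert, not_or]
          exact ⟨hne z hz, fun h => h3 z h hz'.symm⟩
        · refine ContinuousOn.circleIntegrable hρ.le fun z hz => ?_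
          have := (hzp z (hne z hz)).continuousAt.continuousWithinAt (s := Metric.sphere 0 ρ)
          simpa [div_eq_mul_inv] using this
      have hI : (∮ z in C(0, r), (z - p)⁻¹) = 0 := by
        refine Complex.circleIntegral_eq_zero_of_differentiable_on_off_countable hr.le
          (s := ∅) countable_empty ?_ ?_
        · intro z hz
          have hz' : ‖z‖ ≤ r := by simpa using hz
          refine ContinuousAt.continuousWithinAt ?_
          refine ContinuousAt.inv₀ (by fun_prop) (sub_ne_zero.2 ?_)
          rintro rfl; linarith
        · rintro z ⟨hz, -⟩
          have hz' : ‖z‖ < r := by simpa using hz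
          refine DifferentiableAt.inv (by fun_prop) (sub_ne_zero.2 ?_)
          rintro rfl; linarith
      rw [hnp R hR hp2.ne' hrR le_rfl fun p' hp' => (hS p' (Finset.mem_insert_of_mem hp')).2.ne',
        hnp r hr hp1.ne le_rfl hrR fun p' hp' => (hS p' (Finset.mem_insert_of_mem hp')).1.ne,
        circleIntegral.integral_sub_inv_of_mem_ball (by simpa using hp2), hI] at key
      rw [Finset.sum_insert hp]
      linear_combination key
    · intro z h1 h2 h3
      by_cases hz : z = p
      · rwa [hz]
      · exact hd1 z hz (hg z h1 h2 (by simp [hz, h3]))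
    · intro p' hp'
      have hpp : p' ≠ p := fun h => hp (h ▸ hp')
      have h1 := hres p' (Finset.mem_insert_of_mem hp')
      have h2 : Tendsto (fun z => (z - p') * (res p / (z - p))) (𝓝[≠] p') (𝓝 0) := by
        have : ContinuousAt (fun z => (z - p') * (res p / (z - p))) p' :=
          ContinuousAt.mul (by fun_prop) (hzp p' hpp).continuousAt
        simpa using this.tendsto.mono_left nhdsWithin_le_nhds
      have h3 := h1.sub h2
      rw [sub_zero] at h3
      refine h3.congr' ?_
      filter_upwards [nhdsWithin_le_nhds (isOpen_ne.mem_nhds hpp)] with z hz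
      have hz : z ≠ p := hz
      simp only [hg1, Function.update_of_ne hz, hg0]
      ring

/-! ### Infinite `q`-shifted factorials: shift, zeros, holomorphy -/

theorem summable_norm_mul_pow {q : ℂ} (hq : ‖q‖ < 1) (x : ℂ) :
    Summable fun n : ℕ => ‖-(x * q ^ n)‖ := by
  simp only [norm_neg, norm_mul, norm_pow]
  exact (summable_geometric_of_lt_one (norm_nonneg q) hq).mul_left _

theorem qPochInf_eq {q : ℂ} (hq : ‖q‖ < 1) (x : ℂ) :
    qPochInf x q = (1 - x) * qPochInf (q * x) q := by
  have h : Multipliable fun n : ℕ => (1 + -((q * x) * q ^ n)) :=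
    multipliable_one_add_of_summable (summable_norm_mul_pow hq (q * x))
  unfold qPochInf
  rw [tprod_eq_zero_mul']
  · rw [pow_zero, mul_one]
    congr 1
    refine tprod_congr fun n => ?_
    ring
  · refine h.congr fun n => ?_
    ring

theorem qPochInf_ne_zero {q : ℂ} (hq : ‖q‖ < 1) {x : ℂ} (hx : x ∉ qOmega q) :
    qPochInf x q ≠ 0 := by
  unfold qPochInf
  simp_rw [sub_eq_add_neg]
  refine tprod_one_add_ne_zero_of_summable (fun n h => hx ⟨n, ?_⟩) (summable_norm_mul_pow hq x)
  rw [← sub_eq_add_neg, sub_eq_zero] at h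
  exact eq_inv_of_mul_eq_one_left h.symm

theorem differentiable_qPochInf {q : ℂ} (hq : ‖q‖ < 1) :
    Differentiable ℂ fun x => qPochInf x q := by
  have key : HasProdLocallyUniformlyOn (fun (n : ℕ) (x : ℂ) => 1 + -(x * q ^ n))
      (fun x => ∏' n : ℕ, (1 + -(x * q ^ n))) Set.univ := by
    refine hasProdLocallyUniformlyOn_of_forall_compact isOpen_univ fun K _ hK => ?_
    obtain ⟨B, hB⟩ := hK.isBounded.exists_norm_le
    refine Summable.hasProdUniformlyOn_one_add (u := fun n => B * ‖q‖ ^ n) hK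
      ((summable_geometric_of_lt_one (norm_nonneg q) hq).mul_left _) ?_ (fun n => by fun_prop)
    refine Filter.Eventually.of_forall fun n x hx => ?_
    rw [norm_neg, norm_mul, norm_pow]
    exact mul_le_mul_of_nonneg_right (hB x hx) (by positivity)
  have h := key.tendstoLocallyUniformlyOn_finsetRange.differentiableOn
    (Filter.Eventually.of_forall fun n => by fun_prop) isOpen_univ
  rw [differentiableOn_univ] at h
  simpa only [qPochInf, sub_eq_add_neg] using h

theorem notMem_qOmega_of_norm_lt {q x : ℂ} (hq0 : q ≠ 0) (hq : ‖q‖ < 1) (hx : ‖x‖ < 1) :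
    x ∉ qOmega q := by
  rintro ⟨k, rfl⟩
  rw [norm_inv, norm_pow] at hx
  have := norm_pos_iff.2 hq0
  exact absurd (one_le_inv₀ (by positivity) |>.2
    (pow_le_one₀ (norm_nonneg q) hq.le)) (not_le.2 hx)

theorem mul_pow_ne_one_of_notMem_qOmega {q x : ℂ} (hx : x ∉ qOmega q) (k : ℕ) :
    1 - x * q ^ k ≠ 0 := fun h =>
  hx ⟨k, eq_inv_of_mul_eq_one_left (sub_eq_zero.1 h).symm⟩

/-! ### The functional equation under `z ↦ q z` -/

/-- The product `(x z, x / z; q)_∞`. -/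
noncomputable def qPochPair (q x z : ℂ) : ℂ := qPochInf (x * z) q * qPochInf (x / z) q

/-- The integrand `rahmanIntegrand` as a function of `z = e^{iψ}`. -/
noncomputable def rahmanFun (q l m : ℂ) (a : Fin 6 → ℂ) (z : ℂ) : ℂ :=
  qPochInf (z ^ 2) q * qPochInf (z ^ 2)⁻¹ q * (qPochPair q l z * qPochPair q m z) /
    ∏ j, qPochPair q (a j) z

/-- The quotient `rahmanFun (q z) / rahmanFun z`. -/
noncomputable def rahmanRatio (q l m : ℂ) (a : Fin 6 → ℂ) (z : ℂ) : ℂ :=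
  q * l * m / (∏ j, a j) * ((1 - q ^ 2 * z ^ 2) / (1 - z ^ 2)) *
    ((1 - q * z / l) / (1 - l * z) * ((1 - q * z / m) / (1 - m * z))) *
    ∏ j, (1 - a j * z) / (1 - q * z / a j)

/-- Conditions on `z` under which `rahmanRatio` is the quotient it stands for. -/
structure RahmanRegular (q l m : ℂ) (a : Fin 6 → ℂ) (z : ℂ) : Prop where
  norm_lt : ‖z‖ < 1
  left_ne : 1 - l * z ≠ 0
  right_ne : 1 - m * z ≠ 0
  pole_ne : ∀ j, 1 - q * z / a j ≠ 0

theorem one_sub_ne_zero_of_norm_lt {z : ℂ} (hz : ‖z‖ < 1) : 1 - z ≠ 0 := by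
  rw [sub_ne_zero]
  rintro rfl
  simp at hz

theorem norm_mul_lt_one {x y : ℂ} (hx : ‖x‖ < 1) (hy : ‖y‖ ≤ 1) : ‖x * y‖ < 1 := by
  rw [norm_mul]
  exact (mul_le_of_le_one_right (norm_nonneg x) hy).trans_lt hx

section

variable {q l m : ℂ} {a : Fin 6 → ℂ}

theorem qPochPair_mul (hq0 : q ≠ 0) (hq : ‖q‖ < 1) {x z : ℂ} (hx : x ≠ 0) (hz : z ≠ 0)
    (hxz : 1 - x * z ≠ 0) :
    qPochPair q x (q * z) =
      -(x / (q * z)) * ((1 - q * z / x) / (1 - x * z)) * qPochPair q x z := by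
  have h1 := qPochInf_eq hq (x * z)
  have h2 := qPochInf_eq hq (x / (q * z))
  rw [show q * (x / (q * z)) = x / z by field_simp] at h2
  rw [qPochPair, qPochPair, h1, h2, show q * (x * z) = x * (q * z) by ring]
  have h3 : (1 - x / (q * z)) = -(x / (q * z)) * (1 - q * z / x) := by
    field_simp
    ring
  rw [h3]
  field_simp

/-- Each pair `(x z, x / z; q)_∞` contributes a factor `-x / (q z)` besides a quotient of linear
factors. The two numerator pairs give `z ^ (-2)`, the six denominator pairs `z ^ 6`, and the factors
in `z ^ 2` give `z ^ (-4)`: all powers of `z` cancel, so the quotient is finite at `0`. -/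
theorem rahmanFun_mul (hq0 : q ≠ 0) (hq : ‖q‖ < 1) (ha0 : ∀ i, a i ≠ 0) (ha1 : ∀ i, ‖a i‖ < 1)
    (hl : l ≠ 0) (hm : m ≠ 0) {z : ℂ} (hz : z ≠ 0) (h : RahmanRegular q l m a z) :
    rahmanFun q l m a (q * z) = rahmanRatio q l m a z * rahmanFun q l m a z := by
  have hz2 : ‖z ^ 2‖ < 1 := by
    rw [norm_pow]
    exact pow_lt_one₀ (norm_nonneg z) h.norm_lt two_ne_zero
  have n1 : 1 - z ^ 2 ≠ 0 := one_sub_ne_zero_of_norm_lt hz2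
  have n2 : 1 - q * z ^ 2 ≠ 0 := one_sub_ne_zero_of_norm_lt (norm_mul_lt_one hq hz2.le)
  have e1 : qPochInf (z ^ 2) q = (1 - z ^ 2) * ((1 - q * z ^ 2) * qPochInf ((q * z) ^ 2) q) := by
    rw [qPochInf_eq hq, qPochInf_eq hq (q * z ^ 2)]
    ring_nf
  have e2 : qPochInf ((q * z) ^ 2)⁻¹ q =
      (1 - ((q * z) ^ 2)⁻¹) * ((1 - q * ((q * z) ^ 2)⁻¹) * qPochInf (z ^ 2)⁻¹ q) := by
    rw [qPochInf_eq hq, qPochInf_eq hq (q * ((q * z) ^ 2)⁻¹),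
      show q * (q * ((q * z) ^ 2)⁻¹) = (z ^ 2)⁻¹ by field_simp]
  have e3 : ∏ j, qPochPair q (a j) (q * z) = (∏ j, a j) / (q * z) ^ 6 *
      (∏ j, (1 - a j * z) / (1 - q * z / a j))⁻¹ * ∏ j, qPochPair q (a j) z := by
    rw [Finset.prod_congr rfl fun j _ => qPochPair_mul hq0 hq (ha0 j) hz
      (one_sub_ne_zero_of_norm_lt (norm_mul_lt_one (ha1 j) h.norm_lt.le)),
      Finset.prod_mul_distrib, Finset.prod_mul_distrib, Finset.prod_neg, Finset.prod_div_distrib,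
      ← Finset.prod_inv_distrib]
    simp only [Finset.card_univ, Fintype.card_fin, Finset.prod_const, inv_div,
      Finset.prod_div_distrib]
    norm_num
  have hA : ∏ j, a j ≠ 0 := Finset.prod_ne_zero_iff.2 fun j _ => ha0 j
  rw [rahmanFun, rahmanFun, rahmanRatio, e1, e2, e3, qPochPair_mul hq0 hq hl hz h.left_ne,
    qPochPair_mul hq0 hq hm hz h.right_ne]
  generalize (∏ j, (1 - a j * z) / (1 - q * z / a j)) = Q
  generalize (∏ j, qPochPair q (a j) z) = D
  generalize qPochPair q l z = X
  generalize qPochPair q m z = Y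
  generalize (1 - q * z / l) / (1 - l * z) = U
  generalize (1 - q * z / m) / (1 - m * z) = V
  generalize qPochInf ((q * z) ^ 2) q = W
  generalize qPochInf (z ^ 2)⁻¹ q = T
  simp only [div_eq_mul_inv, mul_inv, inv_inv]
  generalize D⁻¹ = D'
  field_simp
  ring

theorem differentiableAt_qPochPair (hq : ‖q‖ < 1) (x : ℂ) {z : ℂ} (hz : z ≠ 0) :
    DifferentiableAt ℂ (qPochPair q x) z := by
  have h := differentiable_qPochInf hq
  exact ((h _).comp z (by fun_prop : DifferentiableAt ℂ (fun z => x * z) z)).mul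
    ((h _).comp z ((differentiableAt_const x).div differentiableAt_id hz :
      DifferentiableAt ℂ (fun z => x / z) z))

theorem differentiableAt_rahmanFun (hq : ‖q‖ < 1) {z : ℂ} (hz : z ≠ 0)
    (h : ∀ j, qPochPair q (a j) z ≠ 0) : DifferentiableAt ℂ (rahmanFun q l m a) z := by
  have hP := differentiable_qPochInf hq
  have h1 : DifferentiableAt ℂ (fun z : ℂ => qPochInf (z ^ 2) q) z :=
    (hP _).comp z (by fun_prop : DifferentiableAt ℂ (fun z : ℂ => z ^ 2) z)
  have h2 : DifferentiableAt ℂ (fun z : ℂ => qPochInf (z ^ 2)⁻¹ q) z :=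
    (hP _).comp z (DifferentiableAt.inv (by fun_prop) (pow_ne_zero 2 hz) :
      DifferentiableAt ℂ (fun z : ℂ => (z ^ 2)⁻¹) z)
  refine ((h1.mul h2).mul ((differentiableAt_qPochPair hq l hz).mul
    (differentiableAt_qPochPair hq m hz))).div ?_ (Finset.prod_ne_zero_iff.2 fun j _ => h j)
  exact DifferentiableAt.fun_finsetProd fun j _ => differentiableAt_qPochPair hq (a j) hz

theorem qPochPair_ne_zero (hq0 : q ≠ 0) (hq : ‖q‖ < 1) {x z : ℂ} (hx : ‖x‖ < 1)
    (hz : z ≠ 0) (hz1 : ‖z‖ ≤ 1) (h : ∀ k : ℕ, z ≠ x * q ^ k) : qPochPair q x z ≠ 0 := by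
  refine mul_ne_zero (qPochInf_ne_zero hq
    (notMem_qOmega_of_norm_lt hq0 hq (norm_mul_lt_one hx hz1))) (qPochInf_ne_zero hq ?_)
  rintro ⟨k, hk⟩
  refine h k ?_
  have := pow_ne_zero k hq0
  field_simp at hk
  exact hk.symm

theorem continuousAt_rahmanRatio {z : ℂ} (h : RahmanRegular q l m a z) :
    ContinuousAt (rahmanRatio q l m a) z := by
  have n1 : 1 - z ^ 2 ≠ 0 := one_sub_ne_zero_of_norm_lt (by
    rw [norm_pow]
    exact pow_lt_one₀ (norm_nonneg z) h.norm_lt two_ne_zero)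
  refine ContinuousAt.mul (ContinuousAt.mul (ContinuousAt.mul continuousAt_const ?_)
    (ContinuousAt.mul ?_ ?_)) (tendsto_finsetProd _ fun j _ => ?_)
  · exact ContinuousAt.div (by fun_prop) (by fun_prop) n1
  · exact ContinuousAt.div (by fun_prop) (by fun_prop) h.left_ne
  · exact ContinuousAt.div (by fun_prop) (by fun_prop) h.right_ne
  · exact ContinuousAt.div (f := fun z => 1 - a j * z) (g := fun z => 1 - q * z / a j)
      (by fun_prop) (by fun_prop) (h.pole_ne j)

theorem RahmanRegular.eventually {z : ℂ} (h : RahmanRegular q l m a z) :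
    ∀ᶠ w in nhds z, RahmanRegular q l m a w := by
  have h1 : ∀ᶠ w in nhds z, ‖w‖ < 1 := (continuous_norm.tendsto z).eventually (gt_mem_nhds h.norm_lt)
  have h2 : ∀ᶠ w in nhds z, 1 - l * w ≠ 0 :=
    (by fun_prop : ContinuousAt (fun w => 1 - l * w) z).eventually_ne h.left_ne
  have h3 : ∀ᶠ w in nhds z, 1 - m * w ≠ 0 :=
    (by fun_prop : ContinuousAt (fun w => 1 - m * w) z).eventually_ne h.right_ne
  have h4 : ∀ᶠ w in nhds z, ∀ j, 1 - q * w / a j ≠ 0 := Filter.eventually_all.2 fun j =>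
    (by fun_prop : ContinuousAt (fun w => 1 - q * w / a j) z).eventually_ne (h.pole_ne j)
  filter_upwards [h1, h2, h3, h4] with w h1 h2 h3 h4
  exact ⟨h1, h2, h3, h4⟩

theorem rahmanRegular_zero : RahmanRegular q l m a 0 := by
  constructor <;> simp

theorem rahmanRatio_zero : rahmanRatio q l m a 0 = q * l * m / ∏ j, a j := by
  simp [rahmanRatio]

/-- The exclusions of `qOmega q` ensure that the functional equation can be used at every pole. -/
theorem rahmanRegular_pole (hq0 : q ≠ 0) (hq : ‖q‖ < 1) (ha0 : ∀ i, a i ≠ 0)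
    (ha1 : ∀ i, ‖a i‖ < 1)
    (haa : ∀ i j, i ≠ j → a i / a j ∉ qOmega q) (hal : ∀ i, a i * l ∉ qOmega q)
    (ham : ∀ i, a i * m ∉ qOmega q) (i : Fin 6) (k : ℕ) :
    RahmanRegular q l m a (a i * q ^ k) where
  norm_lt := norm_mul_lt_one (ha1 i) (by
    rw [norm_pow]
    exact pow_le_one₀ (norm_nonneg q) hq.le)
  left_ne := by
    have := mul_pow_ne_one_of_notMem_qOmega (hal i) k
    rwa [show l * (a i * q ^ k) = a i * l * q ^ k by ring]
  right_ne := by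
    have := mul_pow_ne_one_of_notMem_qOmega (ham i) k
    rwa [show m * (a i * q ^ k) = a i * m * q ^ k by ring]
  pole_ne j := by
    have hi := ha0 i
    have hj := ha0 j
    by_cases h : i = j
    · subst h
      rw [show q * (a i * q ^ k) / a i = q * q ^ k by field_simp]
      exact mul_pow_ne_one_of_notMem_qOmega (notMem_qOmega_of_norm_lt hq0 hq hq) k
    · have := mul_pow_ne_one_of_notMem_qOmega (haa i j h) (k + 1)
      rwa [show q * (a i * q ^ k) / a j = a i / a j * q ^ (k + 1) by ring]

/-! ### Term recurrence of the very-well-poised series -/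

theorem qPochs_succ (as : List ℂ) (q : ℂ) (k : ℕ) :
    qPochs as q (k + 1) = qPochs as q k * (as.map fun x => 1 - x * q ^ k).prod := by
  simp only [qPochs, qPoch, Finset.prod_range_succ, List.prod_map_mul]

theorem qPochs_zero (as : List ℂ) (q : ℂ) : qPochs as q 0 = 1 := by
  simp [qPochs, qPoch]

theorem csqrt_mul_self (b : ℂ) : csqrt b * csqrt b = b := by
  rw [← sq, csqrt, ← Complex.cpow_nat_mul]
  norm_num

/-- The terms of the very-well-poised series attached to the poles `a 0 * q ^ k`. -/
noncomputable def rahmanTerm (q l m : ℂ) (a : Fin 6 → ℂ) (k : ℕ) : ℂ :=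
  qHypTerm (vwpTop (a 0 ^ 2) (rahmanParams q l m a) q)
    (vwpBot (a 0 ^ 2) (rahmanParams q l m a) q) q (q * l * m / ∏ i, a i) k

theorem rahmanTerm_zero : rahmanTerm q l m a 0 = 1 := by
  simp [rahmanTerm, qHypTerm, qPochs_zero, vwpTop, vwpBot, rahmanParams]

theorem rahmanTerm_succ (hq0 : q ≠ 0) (ha0 : ∀ i, a i ≠ 0) (hl : l ≠ 0) (hm : m ≠ 0) (k : ℕ) :
    rahmanTerm q l m a (k + 1) = rahmanRatio q l m a (a 0 * q ^ k) * rahmanTerm q l m a k := by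
  -- The parameters with `±` a square root are multiplied in pairs, so only the square survives and
  -- the branch plays no role.
  have hs := csqrt_mul_self (a 0 ^ 2)
  have e1 : (1 - q * csqrt (a 0 ^ 2) * q ^ k) * (1 - -(q * csqrt (a 0 ^ 2)) * q ^ k) =
      1 - q ^ 2 * (a 0 * q ^ k) ^ 2 := by
    linear_combination -(q ^ 2 * (q ^ k) ^ 2) * hs
  have e2 : (1 - csqrt (a 0 ^ 2) * q ^ k) * (1 - -csqrt (a 0 ^ 2) * q ^ k) =
      1 - (a 0 * q ^ k) ^ 2 := by
    linear_combination -((q ^ k) ^ 2) * hs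
  have e1' := fun X => (mul_assoc _ _ X).symm.trans (congrArg (· * X) e1)
  have e2' := fun X => (mul_assoc _ _ X).symm.trans (congrArg (· * X) e2)
  have e3 : ∀ j, q * a 0 ^ 2 / (a 0 * a j) * q ^ k = q * (a 0 * q ^ k) / a j := by
    intro j
    have := ha0 0
    have := ha0 j
    field_simp
  have e4 : ∀ x, x ≠ 0 → q * a 0 ^ 2 / (q * a 0 / x) * q ^ k = x * (a 0 * q ^ k) := by
    intro x hx
    have := ha0 0
    field_simp
  have e5 : q * q ^ k = q * (a 0 * q ^ k) / a 0 := by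
    have := ha0 0
    field_simp
  have e6 : ∀ x, q * a 0 / x * q ^ k = q * (a 0 * q ^ k) / x := fun x => by ring
  have e7 : ∀ x, a 0 * x * q ^ k = x * (a 0 * q ^ k) := fun x => by ring
  have e8 : a 0 ^ 2 * q ^ k = a 0 * (a 0 * q ^ k) := by ring
  have hlen : ((vwpBot (a 0 ^ 2) (rahmanParams q l m a) q).length : ℤ) + 1 -
      ((vwpTop (a 0 ^ 2) (rahmanParams q l m a) q).length : ℤ) = 0 := by
    simp [vwpTop, vwpBot, rahmanParams]
  rw [rahmanTerm, rahmanTerm, qHypTerm, qHypTerm, hlen, qPochs_succ, qPochs_succ]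
  simp only [zpow_zero, mul_one, pow_succ (q * l * m / ∏ i, a i) k, mul_div_mul_comm]
  have key : ((vwpTop (a 0 ^ 2) (rahmanParams q l m a) q).map fun x => 1 - x * q ^ k).prod /
      ((q :: vwpBot (a 0 ^ 2) (rahmanParams q l m a) q).map fun x => 1 - x * q ^ k).prod *
      (q * l * m / ∏ i, a i) = rahmanRatio q l m a (a 0 * q ^ k) := by
    rw [rahmanRatio]
    simp only [vwpTop, vwpBot, rahmanParams, List.ofFn_succ, List.ofFn_zero, List.map_cons,
      List.map_nil, List.prod_cons, List.prod_nil,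
      List.cons_append, List.nil_append, e3, e4 l hl, e4 m hm, e5, e6, e7, e8,
      Fin.prod_univ_succ, Fin.prod_univ_zero, mul_one, e1', e2']
    simp only [div_eq_mul_inv, mul_inv]
    ring
  rw [← key]
  ring

end

/-! ### Poles, residues and decay near the origin -/

/-- The hypotheses on the parameters of the generalized Rahman integral. -/
structure RahmanParameters (q l m : ℂ) (a : Fin 6 → ℂ) : Prop where
  q_ne : q ≠ 0
  q_lt : ‖q‖ < 1
  a_ne : ∀ i, a i ≠ 0
  a_lt : ∀ i, ‖a i‖ < 1
  l_ne : l ≠ 0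
  m_ne : m ≠ 0
  conv : ‖q * l * m‖ < ‖∏ i, a i‖
  div_notMem : ∀ i j, i ≠ j → a i / a j ∉ qOmega q
  mul_l_notMem : ∀ i, a i * l ∉ qOmega q
  mul_m_notMem : ∀ i, a i * m ∉ qOmega q

section

variable {q l m : ℂ} {a : Fin 6 → ℂ}

namespace RahmanParameters

theorem comp_equiv (h : RahmanParameters q l m a) (σ : Equiv.Perm (Fin 6)) :
    RahmanParameters q l m (a ∘ σ) where
  q_ne := h.q_ne
  q_lt := h.q_lt
  a_ne i := h.a_ne (σ i)
  a_lt i := h.a_lt (σ i)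
  l_ne := h.l_ne
  m_ne := h.m_ne
  conv := by
    have := Equiv.prod_comp σ a
    simpa only [Function.comp_apply, this] using h.conv
  div_notMem i j hij := h.div_notMem _ _ (σ.injective.ne hij)
  mul_l_notMem i := h.mul_l_notMem (σ i)
  mul_m_notMem i := h.mul_m_notMem (σ i)

theorem regular (h : RahmanParameters q l m a) (i : Fin 6) (k : ℕ) :
    RahmanRegular q l m a (a i * q ^ k) :=
  rahmanRegular_pole h.q_ne h.q_lt h.a_ne h.a_lt h.div_notMem h.mul_l_notMem h.mul_m_notMem i k

theorem pole_ne_zero (h : RahmanParameters q l m a) (i : Fin 6) (k : ℕ) : a i * q ^ k ≠ 0 :=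
  mul_ne_zero (h.a_ne i) (pow_ne_zero k h.q_ne)

/-- A coincidence gives `a i = a j * q ^ d` after cancelling the smaller power; this puts `a j / a
i` in `qOmega q` unless `i = j`, and then `q ^ d = 1` forces `d = 0`. -/
theorem pole_injective (h : RahmanParameters q l m a) :
    Function.Injective fun x : Fin 6 × ℕ => a x.1 * q ^ x.2 := by
  have aux : ∀ i j : Fin 6, ∀ k n : ℕ, k ≤ n → a i * q ^ k = a j * q ^ n → i = j ∧ k = n := by
    intro i j k n hkn hij
    obtain ⟨d, rfl⟩ := Nat.exists_eq_add_of_le hkn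
    have hqk := pow_ne_zero k h.q_ne
    have hi := h.a_ne i
    have hj := h.a_ne j
    have h1 : a i = a j * q ^ d := by
      rw [pow_add] at hij
      field_simp at hij
      exact hij
    have hqd := pow_ne_zero d h.q_ne
    have h2 : i = j := by
      by_contra hne
      refine h.div_notMem j i (Ne.symm hne) ⟨d, ?_⟩
      rw [h1]
      field_simp
    subst h2
    refine ⟨rfl, ?_⟩
    have h3 : q ^ d = 1 := (mul_right_eq_self₀.1 h1.symm).resolve_right hi
    rcases Nat.eq_zero_or_pos d with rfl | hd
    · rfl
    · have := pow_lt_one₀ (norm_nonneg q) h.q_lt hd.ne'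
      rw [← norm_pow, h3, norm_one] at this
      exact absurd this (lt_irrefl 1)
  rintro ⟨i, k⟩ ⟨j, n⟩ hij
  rcases le_total k n with hkn | hkn
  · obtain ⟨rfl, rfl⟩ := aux i j k n hkn hij
    rfl
  · obtain ⟨rfl, rfl⟩ := aux j i n k hkn hij.symm
    rfl

/-- The pole comes from the first factor `1 - a 0 / z` of `(a 0 / z; q)_∞`; removing it leaves a
function `G` continuous at `a 0`. There `(z ^ 2; q)_∞` cancels `(a 0 * z; q)_∞`, and the remaining
factors of `(a 0 / z; q)_∞` become `(q; q)_∞`. -/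
theorem residue_zero (h : RahmanParameters q l m a) :
    Filter.Tendsto (fun z => (z - a 0) * (rahmanFun q l m a z / z)) (nhdsWithin (a 0) {a 0}ᶜ)
      (nhds (rahmanCoeff q l m a / qPochInf q q)) := by
  have ha := h.a_ne 0
  have hP := (differentiable_qPochInf h.q_lt).continuous
  have hpair : ∀ x, ContinuousAt (qPochPair q x) (a 0) := fun x =>
    (differentiableAt_qPochPair h.q_lt x ha).continuousAt
  have c1 : ContinuousAt (fun z : ℂ => qPochInf (z ^ 2) q) (a 0) :=
    hP.continuousAt.comp (f := fun z : ℂ => z ^ 2) (by fun_prop)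
  have c2 : ContinuousAt (fun z : ℂ => qPochInf (z ^ 2)⁻¹ q) (a 0) :=
    hP.continuousAt.comp (f := fun z : ℂ => (z ^ 2)⁻¹)
      (ContinuousAt.inv₀ (by fun_prop) (pow_ne_zero 2 ha))
  have c3 : ContinuousAt (fun z : ℂ => qPochInf (a 0 * z) q) (a 0) :=
    hP.continuousAt.comp (f := fun z : ℂ => a 0 * z) (by fun_prop)
  have c4 : ContinuousAt (fun z : ℂ => qPochInf (q * (a 0 / z)) q) (a 0) :=
    hP.continuousAt.comp (f := fun z : ℂ => q * (a 0 / z))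
      (continuousAt_const.mul (continuousAt_const.div continuousAt_id ha))
  have n3 : qPochInf (a 0 * a 0) q ≠ 0 := qPochInf_ne_zero h.q_lt
    (notMem_qOmega_of_norm_lt h.q_ne h.q_lt (norm_mul_lt_one (h.a_lt 0) (h.a_lt 0).le))
  have n4 : qPochInf q q ≠ 0 := qPochInf_ne_zero h.q_lt
    (notMem_qOmega_of_norm_lt h.q_ne h.q_lt h.q_lt)
  have n5 : ∀ j : Fin 5, qPochPair q (a j.succ) (a 0) ≠ 0 := fun j =>
    mul_ne_zero (qPochInf_ne_zero h.q_lt (notMem_qOmega_of_norm_lt h.q_ne h.q_lt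
      (norm_mul_lt_one (h.a_lt _) (h.a_lt 0).le)))
      (qPochInf_ne_zero h.q_lt (h.div_notMem _ _ (Fin.succ_ne_zero j)))
  set G : ℂ → ℂ := fun z => qPochInf (z ^ 2) q * qPochInf (z ^ 2)⁻¹ q *
    (qPochPair q l z * qPochPair q m z) /
    (qPochInf (a 0 * z) q * qPochInf (q * (a 0 / z)) q *
      ∏ j : Fin 5, qPochPair q (a j.succ) z) with hG
  have hGc : ContinuousAt G (a 0) := by
    refine ((c1.mul c2).mul ((hpair l).mul (hpair m))).div
      ((c3.mul c4).mul (tendsto_finsetProd _ fun j _ => hpair _)) ?_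
    refine mul_ne_zero (mul_ne_zero n3 ?_) (Finset.prod_ne_zero_iff.2 fun j _ => n5 j)
    rwa [div_self ha, mul_one]
  have hGa : G (a 0) = rahmanCoeff q l m a / qPochInf q q := by
    simp only [hG, rahmanCoeff, qPochPair, qPochInfs, div_self ha, mul_one, ← sq (a 0),
      Finset.prod_mul_distrib, List.map_cons, List.map_nil, List.prod_cons, List.prod_nil,
      List.map_ofFn, List.prod_ofFn, Function.comp_apply]
    rw [← sq] at n3
    simp only [mul_comm l (a 0), mul_comm m (a 0), mul_comm (a (Fin.succ _)) (a 0)]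
    generalize (∏ i : Fin 5, qPochInf (a 0 * a i.succ) q) = X
    generalize (∏ i : Fin 5, qPochInf (a i.succ / a 0) q) = Y
    simp only [div_eq_mul_inv, mul_inv]
    field_simp
  rw [← hGa]
  refine (hGc.tendsto.mono_left nhdsWithin_le_nhds).congr' ?_
  filter_upwards [self_mem_nhdsWithin, nhdsWithin_le_nhds (isOpen_ne.mem_nhds ha)] with z hz hz0
  have hz0 : z ≠ 0 := hz0
  have hza : z - a 0 ≠ 0 := sub_ne_zero.2 hz
  rw [hG, rahmanFun, Fin.prod_univ_succ, qPochPair.eq_def q (a 0), qPochInf_eq h.q_lt (a 0 / z),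
    show 1 - a 0 / z = (z - a 0) / z by field_simp]
  simp only [div_eq_mul_inv, mul_inv, inv_inv]
  field_simp

/-- The residue of `rahmanFun z / z` at `z = a 0 * q ^ k`. -/
theorem residue (h : RahmanParameters q l m a) (k : ℕ) :
    Filter.Tendsto (fun z => (z - a 0 * q ^ k) * (rahmanFun q l m a z / z))
      (nhdsWithin (a 0 * q ^ k) {a 0 * q ^ k}ᶜ)
      (nhds (rahmanCoeff q l m a / qPochInf q q * rahmanTerm q l m a k)) := by
  induction k with
  | zero => simpa [rahmanTerm_zero] using h.residue_zero
  | succ k ih =>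
    set p := a 0 * q ^ k with hp
    have hreg := h.regular 0 k
    have hq0 := h.q_ne
    -- Substituting `z = q * w` leaves `dz / z` invariant, so the residue is multiplied by
    -- `rahmanRatio` at `p` with no extra power of `q`.
    have h1 : Filter.Tendsto (fun w => (q * w - q * p) * (rahmanFun q l m a (q * w) / (q * w)))
        (nhdsWithin p {p}ᶜ) (nhds (rahmanRatio q l m a p *
          (rahmanCoeff q l m a / qPochInf q q * rahmanTerm q l m a k))) := by
      refine (((continuousAt_rahmanRatio hreg).tendsto.mono_left nhdsWithin_le_nhds).mul
        ih).congr' ?_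
      filter_upwards [nhdsWithin_le_nhds hreg.eventually,
        nhdsWithin_le_nhds (isOpen_ne.mem_nhds (h.pole_ne_zero 0 k))] with w hw hw0
      have hw0 : w ≠ 0 := hw0
      rw [rahmanFun_mul hq0 h.q_lt h.a_ne h.a_lt h.l_ne h.m_ne hw0 hw]
      field_simp
    have h2 : Filter.Tendsto (fun z => q⁻¹ * z) (nhdsWithin (q * p) {q * p}ᶜ)
        (nhdsWithin p {p}ᶜ) := by
      refine tendsto_nhdsWithin_iff.2 ⟨?_, ?_⟩
      · have : Filter.Tendsto (fun z => q⁻¹ * z) (nhds (q * p)) (nhds (q⁻¹ * (q * p))) :=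
          Continuous.tendsto (by fun_prop) _
        rw [inv_mul_cancel_left₀ hq0] at this
        exact this.mono_left nhdsWithin_le_nhds
      · filter_upwards [self_mem_nhdsWithin] with z hz hzp
        refine hz ?_
        rw [Set.mem_singleton_iff] at hzp ⊢
        rw [← hzp, mul_inv_cancel_left₀ hq0]
    have h3 := h1.comp h2
    rw [rahmanTerm_succ hq0 h.a_ne h.l_ne h.m_ne, show a 0 * q ^ (k + 1) = q * p by
      rw [hp]; ring, mul_left_comm (rahmanCoeff q l m a / qPochInf q q)]
    refine h3.congr fun z => ?_
    simp only [Function.comp_apply, mul_inv_cancel_left₀ hq0]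

theorem exists_ratio_bound (h : RahmanParameters q l m a) :
    ∃ d < 1, 0 ≤ d ∧ ∃ ε > 0, ∀ z, ‖z‖ < ε →
      RahmanRegular q l m a z ∧ ‖rahmanRatio q l m a z‖ ≤ d := by
  have hc : ‖q * l * m / ∏ j, a j‖ < 1 := by
    rw [norm_div, div_lt_one ((norm_nonneg _).trans_lt h.conv)]
    exact h.conv
  obtain ⟨d, hd1, hd2⟩ := exists_between hc
  refine ⟨d, hd2, (norm_nonneg _).trans hd1.le, ?_⟩
  have h1 := (continuousAt_rahmanRatio (rahmanRegular_zero (q := q) (l := l) (m := m)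
    (a := a))).norm
  have h2 : ∀ᶠ z in nhds 0, ‖rahmanRatio q l m a z‖ < d :=
    h1.eventually (gt_mem_nhds (by simpa only [rahmanRatio_zero] using hd1))
  obtain ⟨ε, hε, hε'⟩ := Metric.eventually_nhds_iff.1 (rahmanRegular_zero.eventually.and h2)
  refine ⟨ε, hε, fun z hz => ?_⟩
  obtain ⟨h3, h4⟩ := hε' (by simpa using hz)
  exact ⟨h3, h4.le⟩

theorem summable_term (h : RahmanParameters q l m a) : Summable (rahmanTerm q l m a) := by
  obtain ⟨d, hd, -, ε, hε, hb⟩ := h.exists_ratio_bound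
  refine summable_of_ratio_norm_eventually_le hd ?_
  have h1 : Filter.Tendsto (fun k : ℕ => ‖a 0 * q ^ k‖) Filter.atTop (nhds 0) := by
    have := ((tendsto_pow_atTop_nhds_zero_of_norm_lt_one h.q_lt).const_mul (a 0)).norm
    simpa using this
  filter_upwards [h1.eventually (gt_mem_nhds hε)] with k hk
  rw [rahmanTerm_succ h.q_ne h.a_ne h.l_ne h.m_ne, norm_mul]
  exact mul_le_mul_of_nonneg_right (hb _ hk).2 (norm_nonneg _)

theorem _root_.rahmanFun_comp_equiv (q l m : ℂ) (a : Fin 6 → ℂ) (σ : Equiv.Perm (Fin 6)) :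
    rahmanFun q l m (a ∘ σ) = rahmanFun q l m a := by
  ext z
  simp only [rahmanFun, Function.comp_apply]
  rw [Equiv.prod_comp σ fun j => qPochPair q (a j) z]

/-- `rahmanFun` is symmetric in `a`, so the case of `a 0` covers every family of poles. -/
theorem residue_swap (h : RahmanParameters q l m a) (i : Fin 6) (k : ℕ) :
    Filter.Tendsto (fun z => (z - a i * q ^ k) * (rahmanFun q l m a z / z))
      (nhdsWithin (a i * q ^ k) {a i * q ^ k}ᶜ)
      (nhds (rahmanCoeff q l m (a ∘ Equiv.swap 0 i) / qPochInf q q *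
        rahmanTerm q l m (a ∘ Equiv.swap 0 i) k)) := by
  have := (h.comp_equiv (Equiv.swap 0 i)).residue k
  simpa only [rahmanFun_comp_equiv, Function.comp_apply, Equiv.swap_apply_left] using this

theorem differentiableAt (h : RahmanParameters q l m a) {z : ℂ} (hz : z ≠ 0) (hz1 : ‖z‖ ≤ 1)
    (hp : ∀ i, ∀ k : ℕ, z ≠ a i * q ^ k) : DifferentiableAt ℂ (rahmanFun q l m a) z :=
  differentiableAt_rahmanFun h.q_lt hz fun j =>
    qPochPair_ne_zero h.q_ne h.q_lt (h.a_lt j) hz hz1 (hp j)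

theorem norm_rahmanFun_le {d ε : ℝ} (h : RahmanParameters q l m a) (hd : 0 ≤ d)
    (hb : ∀ z, ‖z‖ < ε → RahmanRegular q l m a z ∧ ‖rahmanRatio q l m a z‖ ≤ d)
    {z : ℂ} (hz : z ≠ 0) (hzε : ‖z‖ < ε) (N : ℕ) :
    ‖rahmanFun q l m a (q ^ N * z)‖ ≤ d ^ N * ‖rahmanFun q l m a z‖ := by
  induction N with
  | zero => simp
  | succ N ih =>
    have h1 : ‖q ^ N * z‖ < ε := by
      rw [norm_mul, norm_pow]
      exact (mul_le_of_le_one_left (norm_nonneg z)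
        (pow_le_one₀ (norm_nonneg q) h.q_lt.le)).trans_lt hzε
    obtain ⟨h2, h3⟩ := hb _ h1
    rw [show q ^ (N + 1) * z = q * (q ^ N * z) by ring, rahmanFun_mul h.q_ne h.q_lt h.a_ne h.a_lt
      h.l_ne h.m_ne (mul_ne_zero (pow_ne_zero N h.q_ne) hz) h2, norm_mul, pow_succ', mul_assoc]
    exact mul_le_mul h3 ih (norm_nonneg _) hd

end RahmanParameters

end

/-! ### Shrinking the inner circle -/

section

variable {q l m : ℂ} {a : Fin 6 → ℂ}

/-- The residue of `rahmanFun z / z` at `z = a i * q ^ k`. -/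
noncomputable def rahmanResidue (q l m : ℂ) (a : Fin 6 → ℂ) (x : Fin 6 × ℕ) : ℂ :=
  rahmanCoeff q l m (a ∘ Equiv.swap 0 x.1) / qPochInf q q *
    rahmanTerm q l m (a ∘ Equiv.swap 0 x.1) x.2

namespace RahmanParameters

open Filter Topology

theorem hasSum_residue (h : RahmanParameters q l m a) :
    HasSum (rahmanResidue q l m a) (∑ i, rahmanCoeff q l m (a ∘ Equiv.swap 0 i) / qPochInf q q *
      ∑' k, rahmanTerm q l m (a ∘ Equiv.swap 0 i) k) := by
  have h1 : ∀ i : Fin 6, Summable fun k => rahmanResidue q l m a (i, k) := fun i => by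
    simpa only [rahmanResidue] using (h.comp_equiv (Equiv.swap 0 i)).summable_term.mul_left
      (rahmanCoeff q l m (a ∘ Equiv.swap 0 i) / qPochInf q q)
  have h2 : Summable (rahmanResidue q l m a) := by
    refine Summable.of_norm ((summable_prod_of_nonneg fun _ => norm_nonneg _).2
      ⟨fun i => (h1 i).norm, ?_⟩)
    exact (hasSum_fintype _).summable
  have h3 := h2.hasSum
  rw [h2.tsum_prod, tsum_fintype] at h3
  simpa only [rahmanResidue, tsum_mul_left] using h3

theorem finite_poles (h : RahmanParameters q l m a) {r : ℝ} (hr : 0 < r) :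
    {x : Fin 6 × ℕ | r < ‖a x.1 * q ^ x.2‖}.Finite := by
  obtain ⟨M, hM⟩ := exists_pow_lt_of_lt_one hr h.q_lt
  refine ((Finset.univ : Finset (Fin 6)) ×ˢ Finset.range M).finite_toSet.subset ?_
  rintro ⟨i, k⟩ hx
  rw [Set.mem_ofPred_eq, norm_mul, norm_pow] at hx
  simp only [Finset.coe_product, Finset.coe_univ, Finset.coe_range, Set.mem_prod, Set.mem_univ,
    Set.mem_Iio, true_and]
  by_contra hk
  have h1 := pow_le_pow_of_le_one (norm_nonneg q) h.q_lt.le (not_lt.1 hk)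
  have h2 := mul_le_of_le_one_left (pow_nonneg (norm_nonneg q) k) (h.a_lt i).le
  linarith

theorem circleIntegral_sub (h : RahmanParameters q l m a) {r : ℝ} (hr : 0 < r) (hr1 : r ≤ 1)
    (hra : ∀ i, ∀ k : ℕ, ‖a i * q ^ k‖ ≠ r) :
    (∮ z in C(0, 1), rahmanFun q l m a z / z) - (∮ z in C(0, r), rahmanFun q l m a z / z) =
      2 * Real.pi * Complex.I * ∑ x ∈ (h.finite_poles hr).toFinset, rahmanResidue q l m a x := by
  set S := (h.finite_poles hr).toFinset with hS
  set res : ℂ → ℂ := fun p => limUnder (𝓝[≠] p) fun z => (z - p) * (rahmanFun q l m a z / z)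
    with hres
  have hval : ∀ x : Fin 6 × ℕ, res (a x.1 * q ^ x.2) = rahmanResidue q l m a x := fun x =>
    (h.residue_swap x.1 x.2).limUnder_eq
  have hmem : ∀ x, x ∈ S ↔ r < ‖a x.1 * q ^ x.2‖ := fun x => by simp [hS]
  have key := circleIntegral_sub_eq_sum_residue hr hr1 (S.image fun x => a x.1 * q ^ x.2) res ?_
    (fun z => rahmanFun q l m a z / z) ?_ ?_
  · rw [key, Finset.sum_image fun x _ y _ hxy => h.pole_injective hxy]
    simp only [hval]
  · intro p hp
    obtain ⟨x, hx, rfl⟩ := Finset.mem_image.1 hp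
    exact ⟨(hmem x).1 hx, (h.regular x.1 x.2).norm_lt⟩
  · intro z h1 h2 h3
    have hz : z ≠ 0 := norm_pos_iff.1 (hr.trans_le h1)
    refine (h.differentiableAt hz h2 fun i k hik => h3 ?_).div differentiableAt_id hz
    refine Finset.mem_image.2 ⟨(i, k), (hmem _).2 ?_, hik.symm⟩
    subst hik
    exact lt_of_le_of_ne h1 (hra i k).symm
  · intro p hp
    obtain ⟨x, hx, rfl⟩ := Finset.mem_image.1 hp
    rw [hval]
    exact h.residue_swap x.1 x.2

theorem circleIntegral_eq (h : RahmanParameters q l m a) :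
    (∮ z in C(0, 1), rahmanFun q l m a z / z) = 2 * Real.pi * Complex.I *
      ∑ i, rahmanCoeff q l m (a ∘ Equiv.swap 0 i) / qPochInf q q *
        ∑' k, rahmanTerm q l m (a ∘ Equiv.swap 0 i) k := by
  obtain ⟨d, hd1, hd0, ε, hε, hb⟩ := h.exists_ratio_bound
  have hq : 0 < ‖q‖ := norm_pos_iff.2 h.q_ne
  -- An interval is uncountable, so one `ρ` can be chosen for which no circle of radius `‖q‖ ^ N *
  -- ρ` meets a pole.
  obtain ⟨ρ, ⟨hρ0, hρε⟩, hρ⟩ : ∃ ρ ∈ Set.Ioo 0 (min ε 1),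
      ρ ∉ Set.range fun x : (Fin 6 × ℕ) × ℕ => ‖a x.1.1 * q ^ x.1.2‖ / ‖q‖ ^ x.2 := by
    by_contra! hcon
    exact (Cardinal.Real.Ioo_countable_iff.1 ((Set.countable_range _).mono hcon)).not_gt
      (lt_min hε one_pos)
  have hρ1 := hρε.trans_le (min_le_right ε 1)
  replace hρε := hρε.trans_le (min_le_left ε 1)
  have hrN : ∀ N : ℕ, 0 < ‖q‖ ^ N * ρ := fun N => by positivity
  have hrN1 : ∀ N : ℕ, ‖q‖ ^ N * ρ ≤ 1 := fun N =>
    mul_le_one₀ (pow_le_one₀ hq.le h.q_lt.le) hρ0.le hρ1.le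
  have hrNa : ∀ N : ℕ, ∀ i, ∀ k : ℕ, ‖a i * q ^ k‖ ≠ ‖q‖ ^ N * ρ := fun N i k hik =>
    hρ ⟨((i, k), N), by
      have := pow_ne_zero N hq.ne'
      simp only [hik]
      field_simp⟩
  obtain ⟨B, hB⟩ := (isCompact_sphere (0 : ℂ) ρ).exists_bound_of_continuousOn
    (f := rahmanFun q l m a) fun z hz => by
      have hz' : ‖z‖ = ρ := by simpa using hz
      refine (h.differentiableAt (norm_pos_iff.1 (hz' ▸ hρ0)) (hz'.trans_le hρ1.le)
        fun i k hik => hrNa 0 i k ?_).continuousAt.continuousWithinAt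
      rw [← hik, hz', pow_zero, one_mul]
  have hsmall : Tendsto (fun N : ℕ => ∮ z in C(0, ‖q‖ ^ N * ρ), rahmanFun q l m a z / z) atTop
      (𝓝 0) := by
    -- The length of the circle cancels the `1 / z`; what remains is the bound `B` on the circle of
    -- radius `ρ`, damped by `d` at each of `N` shifts.
    refine squeeze_zero_norm (a := fun N => 2 * Real.pi * (d ^ N * B)) (fun N => ?_) ?_
    · have := circleIntegral.norm_integral_le_of_norm_le_const (hrN N).le
        (f := fun z => rahmanFun q l m a z / z) (c := 0) (C := d ^ N * B / (‖q‖ ^ N * ρ)) ?_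
      · refine this.trans_eq ?_
        have := (hrN N).ne'
        field_simp
      · intro z hz
        have hz' : ‖z‖ = ‖q‖ ^ N * ρ := by simpa using hz
        have hqN := pow_ne_zero N h.q_ne
        obtain ⟨w, rfl⟩ : ∃ w, z = q ^ N * w := ⟨(q ^ N)⁻¹ * z, by field_simp⟩
        have hw : ‖w‖ = ρ := by
          rw [norm_mul, norm_pow] at hz'
          exact mul_left_cancel₀ (pow_ne_zero N hq.ne') hz'
        rw [norm_div, hz']
        refine div_le_div_of_nonneg_right ?_ (hrN N).le
        exact (h.norm_rahmanFun_le hd0 hb (norm_pos_iff.1 (hw ▸ hρ0)) (hw ▸ hρε) N).trans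
          (mul_le_mul_of_nonneg_left (hB w (by simpa using hw)) (pow_nonneg hd0 N))
    · simpa using ((tendsto_pow_atTop_nhds_zero_of_lt_one hd0 hd1).mul_const B).const_mul
        (2 * Real.pi)
  have hr0 : Tendsto (fun N : ℕ => ‖q‖ ^ N * ρ) atTop (𝓝 0) := by
    simpa using (tendsto_pow_atTop_nhds_zero_of_lt_one hq.le h.q_lt).mul_const ρ
  -- The enclosed finite pole sets increase and exhaust all poles, so the residue sums converge to
  -- the unconditional sum.
  have hS : Tendsto (fun N : ℕ => (h.finite_poles (hrN N)).toFinset) atTop atTop := by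
    refine tendsto_atTop_finset_of_monotone (fun N M hNM x hx => ?_) fun x => ?_
    · simp only [Set.Finite.mem_toFinset, Set.mem_ofPred_eq] at hx ⊢
      exact (mul_le_mul_of_nonneg_right (pow_le_pow_of_le_one hq.le h.q_lt.le hNM)
        hρ0.le).trans_lt hx
    · obtain ⟨N, hN⟩ := (hr0.eventually (gt_mem_nhds
        (norm_pos_iff.2 (h.pole_ne_zero x.1 x.2)))).exists
      exact ⟨N, by simpa using hN⟩
  have h1 := (Tendsto.comp h.hasSum_residue hS).const_mul (2 * Real.pi * Complex.I)
  have h2 := (tendsto_const_nhds (x := ∮ z in C(0, 1), rahmanFun q l m a z / z)).sub hsmall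
  rw [sub_zero] at h2
  refine tendsto_nhds_unique h2 (h1.congr fun N => ?_)
  exact (h.circleIntegral_sub (hrN N) (hrN1 N) (hrNa N)).symm

end RahmanParameters

/-! ### From the contour integral back to the integral over `ψ` -/

theorem rahmanIntegrand_eq (q l m : ℂ) (a : Fin 6 → ℂ) (ψ : ℝ) :
    rahmanIntegrand q l m a ψ = rahmanFun q l m a (circleMap 0 1 ψ) := by
  have h1 : circleMap 0 1 ψ = Complex.exp (Complex.I * ψ) := by
    simp [circleMap, mul_comm]
  have h2 : Complex.exp (2 * (Complex.I * ψ)) = Complex.exp (Complex.I * ψ) ^ 2 := by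
    rw [← Complex.exp_nat_mul]
    norm_cast
  simp only [rahmanIntegrand, rahmanFun, h1, h2, Complex.exp_neg, qPochInfs, List.map_cons,
    List.map_nil, List.prod_cons, List.prod_nil, List.map_ofFn, List.prod_ofFn,
    Function.comp_apply, qPochPair, Finset.prod_mul_distrib, mul_one, div_eq_mul_inv, mul_assoc]

theorem RahmanParameters.continuous_rahmanIntegrand (h : RahmanParameters q l m a) :
    Continuous (rahmanIntegrand q l m a) := by
  rw [show rahmanIntegrand q l m a = fun ψ => rahmanFun q l m a (circleMap 0 1 ψ) from
    funext (rahmanIntegrand_eq q l m a), continuous_iff_continuousAt]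
  intro ψ
  have hψ : ‖circleMap 0 1 ψ‖ = 1 := by simp
  refine ContinuousAt.comp (g := rahmanFun q l m a) ?_ (continuous_circleMap 0 1).continuousAt
  refine (h.differentiableAt (norm_pos_iff.1 (one_pos.trans_eq hψ.symm)) hψ.le fun i k hik => ?_).continuousAt
  have := (h.regular i k).norm_lt
  rw [← hik, hψ] at this
  exact lt_irrefl 1 this

theorem integral_rahmanIntegrand (q l m : ℂ) (a : Fin 6 → ℂ) :
    Complex.I * ∫ ψ in (-Real.pi)..Real.pi, rahmanIntegrand q l m a ψ =
      ∮ z in C(0, 1), rahmanFun q l m a z / z := by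
  have hper : Function.Periodic (rahmanIntegrand q l m a) (2 * Real.pi) := fun ψ => by
    rw [rahmanIntegrand_eq, rahmanIntegrand_eq, periodic_circleMap 0 1 ψ]
  have h1 := hper.intervalIntegral_add_eq (-Real.pi) 0
  rw [show -Real.pi + 2 * Real.pi = Real.pi by ring, zero_add] at h1
  rw [h1, circleIntegral, ← intervalIntegral.integral_const_mul]
  refine intervalIntegral.integral_congr fun ψ _ => ?_
  have hψ : circleMap 0 1 ψ ≠ 0 := by simp [circleMap]
  simp only [deriv_circleMap, smul_eq_mul, rahmanIntegrand_eq]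
  field_simp

end

theorem mainTheorem5 (q l m : ℂ) (a : Fin 6 → ℂ)
    (hq0 : q ≠ 0) (hq1 : ‖q‖ < 1)
    (ha0 : ∀ i, a i ≠ 0) (ha1 : ∀ i, ‖a i‖ < 1)
    (hl : l ≠ 0) (hm : m ≠ 0)
    (hconv : ‖q * l * m‖ < ‖∏ i, a i‖)
    (haa : ∀ i j, i ≠ j → a i / a j ∉ qOmega q)
    (hal : ∀ i, a i * l ∉ qOmega q)
    (ham : ∀ i, a i * m ∉ qOmega q) :
    IntervalIntegrable (rahmanIntegrand q l m a) volume (-Real.pi) Real.pi ∧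
    (∀ k : Fin 6, qWConverges ((a k) ^ 2) (rahmanParams q l m (a ∘ Equiv.swap 0 k)) q
      (q * l * m / ∏ i, a i)) ∧
    ∫ ψ in (-Real.pi)..Real.pi, rahmanIntegrand q l m a ψ =
      2 * Real.pi / qPochInf q q *
        symSum (fun c : Fin 6 → ℂ =>
          rahmanCoeff q l m c *
            qW ((c 0) ^ 2) (rahmanParams q l m c) q (q * l * m / ∏ i, c i)) a := by
  have h : RahmanParameters q l m a := ⟨hq0, hq1, ha0, ha1, hl, hm, hconv, haa, hal, ham⟩
  refine ⟨h.continuous_rahmanIntegrand.intervalIntegrable _ _, fun k => ?_, ?_⟩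
  · have h1 := (h.comp_equiv (Equiv.swap 0 k)).summable_term
    have h2 : ∏ i, (a ∘ Equiv.swap 0 k) i = ∏ i, a i := Equiv.prod_comp (Equiv.swap 0 k) a
    have h3 : (a ∘ Equiv.swap 0 k) 0 = a k := by simp
    unfold rahmanTerm at h1
    rwa [h2, h3] at h1
  · have h1 := (integral_rahmanIntegrand q l m a).trans h.circleIntegral_eq
    have h2 : a ∘ Equiv.swap (0 : Fin 6) 0 = a := by simp
    have h3 : symSum (fun c : Fin 6 → ℂ => rahmanCoeff q l m c *
        qW ((c 0) ^ 2) (rahmanParams q l m c) q (q * l * m / ∏ i, c i)) a =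
        ∑ i, rahmanCoeff q l m (a ∘ Equiv.swap 0 i) *
          ∑' k, rahmanTerm q l m (a ∘ Equiv.swap 0 i) k := by
      -- The unpermuted term of `symSum` is the index `0`, where the swap is trivial.
      refine Eq.symm ((Fin.sum_univ_succ _).trans ?_)
      rw [h2]
      rfl
    refine mul_left_cancel₀ Complex.I_ne_zero (h1.trans ?_)
    rw [h3]
    simp only [Finset.mul_sum]
    refine Finset.sum_congr rfl fun i _ => ?_
    ring
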